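/- For $N\ge 0$ let $\mathcal I_N : C([-1,1])\to C([-1,1])$ be Chebyshev interpolation of degree $N$: $\mathcal I_N f$ is the polynomial of degree at most $N$ that agrees with $f$ in the $N+1$ Chebyshev nodes $t_i=\cos\bigl((2i-1)\pi/(2(N+1))\bigr)$, $i=1,\dots,N+1$. Let $\Lambda_N=\|\mathcal I_N\|$ be its operator norm with respect to the sup norm on $C([-1,1])$ (the Lebesgue constant). For $N_1,\dots,N_m\ge 0$ let $\mathcal I_{N_1}\otimes\dots\otimes\mathcal I_{N_m}$ be the tensorized interpolation operator on functions on $[-1,1]^m$, that is, $$(\mathcal I_{N_1}\otimes\dots\otimes\mathcal I_{N_m})f\,(x)=\sum_{i_1=1}^{N_1+1}\cdots\sum_{i_m=1}^{N_m+1} f\bigl(t^{(1)}_{i_1},\dots,t^{(m)}_{i_m}\bigr)\,\ell^{(1)}_{i_1}(x_1)\cdots\ell^{(m)}_{i_m}(x_m),$$ where $t^{(k)}_i$ are the $N_k+1$ Chebyshev nodes in direction $k$ and $\ell^{(k)}_i$ their Lagrange basis polynomials. Corollary. Let $g:[-1,1]^m\to\mathbb R$, and let $\rho_k>1$ and $C_k\in\mathbb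 R$ for $k=1,\dots,m$. Assume that for every $k$, and for all values in $[-1,1]$ of the other arguments, $g$ as a function of its $k$th argument has an analytic continuation to the open region inside the Bernstein ellipse $\{(\rho_k e^{i\theta}+\rho_k^{-1}e^{-i\theta})/2 : \theta\in\mathbb R\}$ whose modulus is bounded there by $C_k$. Let $\hat g=(\mathcal I_{N_1}\otimes\dots\otimes\mathcal I_{N_m})(g+e)$, where $e:[-1,1]^m\to\mathbb R$ represents an evaluation error, and let $\|e\|_\infty$ be the maximum of $|e|$ over the grid of interpolation nodes (which is at most the supremum of $|e|$ over $[-1,1]^m$). Then $$\sup_{x\in[-1,1]^m}|g(x)-\hat g(x)|\le\sum_{k=1}^m\frac{4\,\Lambda_{N_1}\cdots\Lambda_{N_{k-1}}\,C_k}{(\rho_k-1)\rho_k^{N_k}}+\Lambda_{N_1}\cdots\Lambda_{N_m}\|e\|_\infty,$$ where $\Lambda_N\le\frac2\pi\log(N+1)+1$ for every $N\ge 0$. In particular, if $N_1=\dots=N_m=N\ge 1$, $\rho_1=\dots=\rho_m=\rho$ and $C_1=\dots=C_m=C$, then $\Lambda_N>1$ and $$\sup_{x\in[-1,1]^m}|g(x)-\hat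 g(x)|\le\frac{4(\Lambda_N^m-1)\,C}{(\rho-1)\rho^N(\Lambda_N-1)}+\Lambda_N^m\|e\|_\infty.$$ -/

import Mathlib

open scoped BigOperators

noncomputable section

namespace ChebInterp

/-- The interval `[-1, 1]`. The cube `[-1, 1]^m` is `Fin m → I`. -/
abbrev I : Type := Set.Icc (-1 : ℝ) 1

/-- The Chebyshev nodes `cos ((2 i - 1) π / (2 (N + 1)))`, `i = 1, …, N + 1`
(with `i` shifted so that it starts at `0`). -/
def node (N : ℕ) (i : Fin (N + 1)) : I :=
  ⟨Real.cos ((2 * ((i : ℕ) : ℝ) + 1) * Real.pi / (2 * ((N : ℝ) + 1))),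
    Real.neg_one_le_cos _, Real.cos_le_one _⟩

/-- The Lagrange basis polynomials of the `N + 1` Chebyshev nodes, as functions on `[-1, 1]`. -/
def basis (N : ℕ) (i : Fin (N + 1)) : C(I, ℝ) :=
  (Lagrange.basis Finset.univ (fun j : Fin (N + 1) => (node N j : ℝ)) i).toContinuousMapOn
    (Set.Icc (-1 : ℝ) 1)

/-- Univariate Chebyshev interpolation of degree `N`: the operator on `C([-1, 1])` that maps `f`
to the polynomial of degree at most `N` that agrees with `f` in the `N + 1` Chebyshev nodes. -/
def interp (N : ℕ) : C(I, ℝ) →L[ℝ] C(I, ℝ) :=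
  ∑ i : Fin (N + 1), (ContinuousMap.evalCLM ℝ (node N i)).smulRight (basis N i)

/-- The Lebesgue constant `Λ_N`: the operator norm of degree-`N` Chebyshev interpolation with
respect to the sup norm on `C([-1, 1])`. -/
def lebesgueConst (N : ℕ) : ℝ := ‖interp N‖

/-- The points of the tensor grid of Chebyshev nodes, with `N k + 1` nodes in direction `k`. -/
def grid {m : ℕ} (N : Fin m → ℕ) (i : (k : Fin m) → Fin (N k + 1)) : Fin m → I :=
  fun k => node (N k) (i k)

/-- Tensorized Chebyshev interpolation `I_{N 1} ⊗ ⋯ ⊗ I_{N m}` of a function on `[-1, 1]^m`. -/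
def tensorInterp {m : ℕ} (N : Fin m → ℕ) (f : (Fin m → I) → ℝ) : (Fin m → I) → ℝ :=
  fun x => ∑ i : (k : Fin m) → Fin (N k + 1), f (grid N i) * ∏ k, basis (N k) (i k) (x k)

/-- The region inside the Bernstein ellipse `{(ρ e^{iθ} + ρ⁻¹ e^{-iθ}) / 2}`, as the union of the
confocal ellipses with parameter `r = ‖w‖`, `1 ≤ r < ρ` (for `r = 1` this is the segment
`[-1, 1]`). -/
def bernsteinEllipse (ρ : ℝ) : Set ℂ :=
  (fun w : ℂ => (w + w⁻¹) / 2) '' {w : ℂ | 1 ≤ ‖w‖ ∧ ‖w‖ < ρ}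

/-- `g` is analytic in its `k`th argument, the others being fixed in `[-1, 1]`, with an analytic
continuation inside the Bernstein ellipse with parameter `ρ` that is bounded there by `C`. -/
def HasBoundedContinuation {m : ℕ} (g : (Fin m → I) → ℝ) (k : Fin m) (ρ C : ℝ) : Prop :=
  ∀ x : Fin m → I, ∃ G : ℂ → ℂ,
    AnalyticOnNhd ℂ G (bernsteinEllipse ρ) ∧
    (∀ z ∈ bernsteinEllipse ρ, ‖G z‖ ≤ C) ∧
    ∀ t : I, G ((t : ℝ) : ℂ) = ((g (Function.update x k t) : ℝ) : ℂ)

end ChebInterp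

end

/-! The substitution `x = (w + w⁻¹) / 2` turns a function that is analytic and bounded by `C` inside
the Bernstein ellipse into a function on the annulus `1 ≤ ‖w‖ < ρ` that is even in `θ` on the circle
`w = exp (θ i)`, so Cauchy's estimate bounds its Chebyshev coefficients by `C ρ ^ (-|n|)`, `n ∈ ℤ`.
Interpolation of degree `N` reproduces `T_n` for `|n| ≤ N`, and by aliasing it maps every other
`T_n` to a function bounded by `1`; the error is thus at most twice the geometric tail over
`|n| > N`.

On the cube the coordinates are discretized one after another, and the Lebesgue constants of the
earlier directions amplify the error made in the current one. The evaluation error is amplified by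
all of them, because the Lebesgue function of a tensor product is the product of the Lebesgue
functions.

For the logarithmic bound on `Λ_N`, put `x = cos θ`. The Lebesgue function is then
`|cos ((N + 1) θ)| / (2 (N + 1))` times a sum of absolute differences of cotangents; with the
sum of all `2 (N + 1)` absolute cotangents instead it is largest at `θ = 0`, where it is compared
with a harmonic sum by means of `cot x ≤ 1 / x - x / 3`. -/

noncomputable section

namespace ChebInterp

open Real Polynomial MeasureTheory

section QuasiInterpolation

lemma exists_continuousMap_forall_mem_of_injective {ι X : Type*} [Finite ι] [TopologicalSpace X]
    [NormalSpace X] [T1Space X] {p : ι → X} (hp : Function.Injective p) {t : Set ℝ} [t.OrdConnected]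
    (ht : t.Nonempty) {a : ι → ℝ} (ha : ∀ i, a i ∈ t) :
    ∃ f : C(X, ℝ), (∀ x, f x ∈ t) ∧ ∀ i, f (p i) = a i := by
  let _ : TopologicalSpace ι := ⊥
  have : DiscreteTopology ι := ⟨rfl⟩
  have hemb : Topology.IsClosedEmbedding p := .of_continuous_injective_isClosedMap
    continuous_of_discreteTopology hp fun s _ => (s.toFinite.image p).isClosed
  obtain ⟨f, hft, hfa⟩ := ContinuousMap.exists_extension_forall_mem_of_isClosedEmbedding
    ⟨a, continuous_of_discreteTopology⟩ ha ht hemb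
  exact ⟨f, hft, congrFun hfa⟩

variable {ι X : Type*} [Fintype ι]

/-- The operator `f ↦ ∑ i, f (p i) b i` with sample points `p` and basis functions `b`. It is an
interpolation operator if `b i (p j) = δ i j`, which is not required here. -/
def quasiInterp (p : ι → X) (b : ι → X → ℝ) (f : X → ℝ) (x : X) : ℝ :=
  ∑ i, f (p i) * b i x

/-- The Lebesgue function of the basis functions `b`, whose supremum is the norm of the
corresponding quasi-interpolation operators. -/
def lebesgueFunction (b : ι → X → ℝ) (x : X) : ℝ :=
  ∑ i, |b i x|

lemma quasiInterp_add (p : ι → X) (b : ι → X → ℝ) (f g : X → ℝ) (x : X) :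
    quasiInterp p b (f + g) x = quasiInterp p b f x + quasiInterp p b g x := by
  simp [quasiInterp, add_mul, Finset.sum_add_distrib]

lemma lebesgueFunction_nonneg (b : ι → X → ℝ) (x : X) : 0 ≤ lebesgueFunction b x :=
  Finset.sum_nonneg fun _ _ => abs_nonneg _

lemma abs_sum_mul_le_lebesgueFunction_mul {a : ι → ℝ} {B : ℝ} (ha : ∀ i, |a i| ≤ B)
    (b : ι → X → ℝ) (x : X) : |∑ i, a i * b i x| ≤ lebesgueFunction b x * B :=
  calc |∑ i, a i * b i x| ≤ ∑ i, |a i * b i x| := Finset.abs_sum_le_sum_abs _ _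
    _ ≤ ∑ i, |b i x| * B := Finset.sum_le_sum fun i _ => by
        rw [abs_mul, mul_comm]
        gcongr
        exact ha i
    _ = lebesgueFunction b x * B := (Finset.sum_mul _ _ _).symm

variable [TopologicalSpace X] [CompactSpace X]

/-- Quasi-interpolation with continuous basis functions, as an operator on `C(X, ℝ)`. -/
def quasiInterpCLM (p : ι → X) (b : ι → C(X, ℝ)) : C(X, ℝ) →L[ℝ] C(X, ℝ) :=
  ∑ i, (ContinuousMap.evalCLM ℝ (p i)).smulRight (b i)

lemma quasiInterpCLM_apply (p : ι → X) (b : ι → C(X, ℝ)) (f : C(X, ℝ)) (x : X) :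
    quasiInterpCLM p b f x = quasiInterp p (fun i => b i) f x := by
  simp [quasiInterpCLM, quasiInterp, ContinuousMap.sum_apply]

lemma lebesgueFunction_le_norm_quasiInterpCLM [T2Space X] {p : ι → X}
    (hp : Function.Injective p) (b : ι → C(X, ℝ)) (x : X) :
    lebesgueFunction (fun i => b i) x ≤ ‖quasiInterpCLM p b‖ := by
  obtain ⟨f, hf, hfp⟩ : ∃ f : C(X, ℝ), (∀ y, f y ∈ Set.Icc (-1 : ℝ) 1) ∧
      ∀ i, f (p i) = SignType.sign (b i x) :=
    exists_continuousMap_forall_mem_of_injective hp ⟨0, by norm_num⟩ fun i => by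
      rcases SignType.sign (b i x) with _ | _ | _ <;> norm_num
  have hf1 : ‖f‖ ≤ 1 := (ContinuousMap.norm_le f zero_le_one).2 fun y => abs_le.2 (hf y)
  have hfx : quasiInterpCLM p b f x = lebesgueFunction (fun i => b i) x := by
    rw [quasiInterpCLM_apply]
    exact Finset.sum_congr rfl fun i _ => by rw [hfp, sign_mul_self]
  calc lebesgueFunction (fun i => b i) x = quasiInterpCLM p b f x := hfx.symm
    _ ≤ ‖quasiInterpCLM p b f‖ := (le_abs_self _).trans ((quasiInterpCLM p b f).norm_coe_le_norm x)
    _ ≤ ‖quasiInterpCLM p b‖ := ContinuousLinearMap.unit_le_opNorm _ f hf1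

lemma isLUB_range_lebesgueFunction [T2Space X] [Nonempty X] {p : ι → X}
    (hp : Function.Injective p) (b : ι → C(X, ℝ)) :
    IsLUB (Set.range (lebesgueFunction fun i => b i)) ‖quasiInterpCLM p b‖ := by
  refine ⟨Set.forall_mem_range.2 (lebesgueFunction_le_norm_quasiInterpCLM hp b), fun B hB => ?_⟩
  have hB (x : X) : lebesgueFunction (fun i => b i) x ≤ B := hB (Set.mem_range_self x)
  have hB0 : 0 ≤ B := (lebesgueFunction_nonneg _ _).trans (hB (Classical.arbitrary X))
  refine ContinuousLinearMap.opNorm_le_bound _ hB0 fun f => ?_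
  refine (ContinuousMap.norm_le _ (by positivity)).2 fun x => ?_
  rw [quasiInterpCLM_apply]
  exact (abs_sum_mul_le_lebesgueFunction_mul (fun i => f.norm_coe_le_norm (p i)) _ x).trans
    (mul_le_mul_of_nonneg_right (hB x) (norm_nonneg f))

end QuasiInterpolation

section TensorProduct

/-- The tensor product basis functions `x ↦ ∏ k, b k (i k) (x k)`. Quasi-interpolation with them and
with the sample points `Pi.map p` is the tensor product of the one-dimensional operators. -/
def tensorBasis {κ : Type*} [Fintype κ] {ι X : κ → Type*} (b : ∀ k, ι k → X k → ℝ)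
    (i : ∀ k, ι k) (x : ∀ k, X k) : ℝ :=
  ∏ k, b k (i k) (x k)

lemma lebesgueFunction_tensorBasis {κ : Type*} [Fintype κ] [DecidableEq κ] {ι X : κ → Type*}
    [∀ k, Fintype (ι k)] (b : ∀ k, ι k → X k → ℝ) (x : ∀ k, X k) :
    lebesgueFunction (tensorBasis b) x = ∏ k, lebesgueFunction (b k) (x k) := by
  simp only [lebesgueFunction, tensorBasis, Finset.abs_prod, Finset.prod_univ_sum,
    Fintype.piFinset_univ]

lemma quasiInterp_tensorBasis_succ {m : ℕ} {ι X : Fin (m + 1) → Type*} [∀ k, Fintype (ι k)]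
    (p : ∀ k, ι k → X k) (b : ∀ k, ι k → X k → ℝ) (f : (∀ k, X k) → ℝ) (x : ∀ k, X k) :
    quasiInterp (Pi.map p) (tensorBasis b) f x =
      quasiInterp (p 0) (b 0) (fun t => quasiInterp (Pi.map fun k : Fin m => p k.succ)
        (tensorBasis fun k => b k.succ) (fun y => f (Fin.cons t y)) (Fin.tail x)) (x 0) := by
  have hcons (i₀ : ι 0) (i : ∀ k : Fin m, ι k.succ) :
      Pi.map p (Fin.cons i₀ i) = Fin.cons (p 0 i₀) (Pi.map (fun k => p k.succ) i) := by
    funext k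
    cases k using Fin.cases <;> rfl
  simp only [quasiInterp, Finset.sum_mul]
  rw [← (Fin.consEquiv ι).sum_comp, Fintype.sum_prod_type]
  refine Fintype.sum_congr _ _ fun i₀ => Fintype.sum_congr _ _ fun i => ?_
  change f (Pi.map p (Fin.cons i₀ i)) * ∏ k, b k (Fin.cons i₀ i k) (x k) = _
  rw [hcons, Fin.prod_univ_succ, mul_assoc, mul_comm (b 0 _ _)]
  rfl

lemma prod_filter_lt_succ {M : Type*} [CommMonoid M] {m : ℕ} (a : Fin (m + 1) → M) (k : Fin m) :
    ∏ j with j < k.succ, a j = a 0 * ∏ j : Fin m with j < k, a j.succ := by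
  simp only [Finset.prod_filter, Fin.prod_univ_succ, Fin.succ_pos, if_true,
    Fin.succ_lt_succ_iff]

/-- The coordinates are discretized one after the other; the error made in coordinate `k` is
amplified by the operators that act on the coordinates before it. -/
lemma abs_sub_quasiInterp_tensorBasis_le {m : ℕ} {ι X : Fin m → Type*} [∀ k, Fintype (ι k)]
    {p : ∀ k, ι k → X k} {b : ∀ k, ι k → X k → ℝ} {f : (∀ k, X k) → ℝ} {B : Fin m → ℝ}
    (hf : ∀ k x, |f x - quasiInterp (p k) (b k) (fun t => f (Function.update x k t)) (x k)| ≤ B k)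
    (x : ∀ k, X k) :
    |f x - quasiInterp (Pi.map p) (tensorBasis b) f x| ≤
      ∑ k, (∏ j with j < k, lebesgueFunction (b j) (x j)) * B k := by
  induction m with
  | zero =>
    have : f (Pi.map p default) = f x := congrArg f (Subsingleton.elim _ _)
    simp [quasiInterp, tensorBasis, this]
  | succ m ih =>
    have first_coordinate :
        |f x - quasiInterp (p 0) (b 0) (fun t => f (Fin.cons t (Fin.tail x))) (x 0)| ≤ B 0 := by
      have hx (t : X 0) : Function.update x 0 t = Fin.cons t (Fin.tail x) := by
        rw [← Fin.update_cons_zero (x 0), Fin.cons_self_tail]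
      simpa only [hx] using hf 0 x
    have other_coordinates (t : X 0) := ih (p := fun k => p k.succ) (b := fun k => b k.succ)
      (f := fun y => f (Fin.cons t y)) (B := fun k => B k.succ)
      (fun k y => by simpa only [Fin.cons_update, Fin.cons_succ] using hf k.succ (Fin.cons t y))
      (Fin.tail x)
    have amplified := abs_sum_mul_le_lebesgueFunction_mul
      (fun i : ι 0 => other_coordinates (p 0 i)) (b 0) (x 0)
    simp only [sub_mul, Finset.sum_sub_distrib] at amplified
    rw [quasiInterp_tensorBasis_succ, Fin.sum_univ_succ]
    refine (abs_sub_le _ _ _).trans (add_le_add (first_coordinate.trans_eq ?_)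
      (amplified.trans_eq ?_))
    · simp
    · simp only [Finset.mul_sum, prod_filter_lt_succ, mul_assoc]
      rfl

end TensorProduct

section ChebyshevNodes

lemma nodal_eq_C_mul_lagrangeBasis {F ι : Type*} [Field F] [DecidableEq ι] {s : Finset ι}
    {v : ι → F} (hv : Set.InjOn v s) {i : ι} (hi : i ∈ s) :
    Lagrange.nodal s v =
      C ((Lagrange.nodal s v).derivative.eval (v i)) * (Lagrange.basis s v i * (X - C (v i))) := by
  have hne : (Lagrange.nodal s v).derivative.eval (v i) ≠ 0 := by
    rw [Lagrange.eval_nodal_derivative_eval_node_eq hi, Lagrange.eval_nodal,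
      Finset.prod_ne_zero_iff]
    intro j hj
    obtain ⟨hji, hj⟩ := Finset.mem_erase.1 hj
    exact sub_ne_zero.2 fun h => hji (hv hj hi h.symm)
  rw [Lagrange.basis_eq_prod_sub_inv_mul_nodal_div hi,
    Lagrange.nodalWeight_eq_eval_derivative_nodal hi, ← Lagrange.nodal_erase_eq_nodal_div hi,
    ← mul_assoc, ← mul_assoc, ← C_mul, mul_inv_cancel₀ hne, C_1, one_mul, mul_comm,
    ← Lagrange.nodal_eq_mul_nodal_erase hi]

/-- The angle of the `i`th Chebyshev node. -/
def angle (N : ℕ) (i : Fin (N + 1)) : ℝ := (2 * ((i : ℕ) : ℝ) + 1) * π / (2 * ((N : ℝ) + 1))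

variable (N : ℕ) (i : Fin (N + 1))

lemma coe_node : (node N i : ℝ) = cos (angle N i) := rfl

lemma angle_pos : 0 < angle N i := by
  unfold angle
  positivity

lemma succ_mul_angle : ((N : ℝ) + 1) * angle N i = (i : ℕ) * π + π / 2 := by
  unfold angle
  field_simp

lemma angle_lt_pi : angle N i < π := by
  have hi : ((i : ℕ) : ℝ) + 1 ≤ N + 1 := by exact_mod_cast i.2
  refine lt_of_mul_lt_mul_left ?_ (show (0 : ℝ) ≤ N + 1 by positivity)
  rw [succ_mul_angle]
  nlinarith [pi_pos]

lemma sin_angle_pos : 0 < sin (angle N i) :=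
  sin_pos_of_pos_of_lt_pi (angle_pos N i) (angle_lt_pi N i)

lemma angle_injective : Function.Injective (angle N) := by
  intro i j h
  have hij : ((i : ℕ) : ℝ) * π = (j : ℕ) * π :=
    add_right_cancel (by rw [← succ_mul_angle, h, succ_mul_angle])
  exact Fin.ext (by exact_mod_cast mul_right_cancel₀ pi_ne_zero hij)

lemma node_injective : Function.Injective (node N) := fun i j h =>
  angle_injective N (injOn_cos ⟨(angle_pos N i).le, (angle_lt_pi N i).le⟩
    ⟨(angle_pos N j).le, (angle_lt_pi N j).le⟩ (congrArg Subtype.val h))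

lemma coe_node_injective : Function.Injective fun j => (node N j : ℝ) :=
  Subtype.val_injective.comp (node_injective N)

lemma exists_eq_cos (x : I) : ∃ θ : ℝ, (x : ℝ) = cos θ :=
  ⟨arccos x, (cos_arccos x.2.1 x.2.2).symm⟩

lemma eval_T_node : (Chebyshev.T ℝ (N + 1)).eval (node N i : ℝ) = 0 := by
  rw [coe_node, Chebyshev.T_real_cos]
  push_cast
  rw [succ_mul_angle, cos_add_pi_div_two, sin_nat_mul_pi, neg_zero]

lemma eval_derivative_T_node :
    (Chebyshev.T ℝ (N + 1)).derivative.eval (node N i : ℝ) * sin (angle N i) =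
      (N + 1) * (-1) ^ (i : ℕ) := by
  rw [Chebyshev.T_derivative_eq_U, add_sub_cancel_right, eval_mul, mul_assoc, coe_node,
    Chebyshev.U_real_cos]
  push_cast
  rw [succ_mul_angle, sin_add_pi_div_two, cos_nat_mul_pi]
  simp

lemma T_eq_C_mul_nodal :
    Chebyshev.T ℝ (N + 1) = C (2 ^ N) * Lagrange.nodal Finset.univ fun j => (node N j : ℝ) := by
  have hdeg : (Chebyshev.T ℝ (N + 1)).degree = (N + 1 : ℕ) := Chebyshev.degree_T ℝ (N + 1)
  have hlead : (Chebyshev.T ℝ (N + 1)).leadingCoeff = 2 ^ N := Chebyshev.leadingCoeff_T ℝ (N + 1)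
  refine eq_of_degree_le_of_eval_index_eq Finset.univ (coe_node_injective N).injOn ?_ ?_ ?_ ?_
  · simp [hdeg]
  · simp [hdeg, Lagrange.degree_nodal]
  · simp [hlead, Lagrange.nodal_monic.leadingCoeff]
  · intro j hj
    rw [eval_T_node, eval_mul, Lagrange.eval_nodal_at_node (v := fun j => (node N j : ℝ)) hj,
      mul_zero]

lemma basis_apply (x : I) :
    basis N i x = (Lagrange.basis Finset.univ (fun j => (node N j : ℝ)) i).eval (x : ℝ) := rfl

lemma eval_T_eq_mul_basis (x : I) : (Chebyshev.T ℝ (N + 1)).eval (x : ℝ) =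
    (Chebyshev.T ℝ (N + 1)).derivative.eval (node N i : ℝ) * (basis N i x * (x - node N i)) := by
  have h := congrArg (eval (x : ℝ)) <|
    nodal_eq_C_mul_lagrangeBasis (coe_node_injective N).injOn (Finset.mem_univ i)
  simp only [eval_mul, eval_C, eval_sub, eval_X] at h
  rw [T_eq_C_mul_nodal, derivative_C_mul, eval_C_mul, eval_C_mul, h, basis_apply]
  ring

lemma basis_mul_cos_sub_cos {x : I} {θ : ℝ} (hx : (x : ℝ) = cos θ) :
    basis N i x * (((N : ℝ) + 1) * (cos θ - cos (angle N i))) =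
      (-1) ^ (i : ℕ) * sin (angle N i) * cos (((N : ℝ) + 1) * θ) := by
  have hT := eval_T_eq_mul_basis N i x
  have hT' := eval_derivative_T_node N i
  have hsq : ((-1 : ℝ) ^ (i : ℕ)) * (-1) ^ (i : ℕ) = 1 := by simp [← mul_pow]
  rw [hx, Chebyshev.T_real_cos, coe_node] at hT
  rw [coe_node] at hT'
  push_cast at hT
  linear_combination (-(-1 : ℝ) ^ (i : ℕ) * sin (angle N i)) * hT -
    (-1) ^ (i : ℕ) * basis N i x * (cos θ - cos (angle N i)) * hT' -
    (N + 1) * basis N i x * (cos θ - cos (angle N i)) * hsq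

lemma basis_node (j : Fin (N + 1)) : basis N i (node N j) = if i = j then 1 else 0 := by
  rw [basis_apply]
  split_ifs with h
  · subst h
    exact Lagrange.eval_basis_self (coe_node_injective N).injOn (Finset.mem_univ i)
  · exact Lagrange.eval_basis_of_ne (v := fun j => (node N j : ℝ)) h (Finset.mem_univ j)

lemma quasiInterp_basis_eval {p : ℝ[X]} (hp : p.natDegree ≤ N) (x : I) :
    quasiInterp (node N) (fun i => basis N i) (fun t => p.eval (t : ℝ)) x = p.eval (x : ℝ) := by
  have hdeg : p.degree < (Finset.univ : Finset (Fin (N + 1))).card := by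
    rw [Finset.card_univ, Fintype.card_fin]
    exact (degree_le_of_natDegree_le hp).trans_lt (by exact_mod_cast N.lt_succ_self)
  conv_rhs => rw [Lagrange.eq_interpolate (coe_node_injective N).injOn hdeg]
  simp [quasiInterp, Lagrange.interpolate_apply, eval_finsetSum, basis_apply]

lemma sum_basis_eq_one (x : I) : ∑ i, basis N i x = 1 := by
  simpa [quasiInterp] using quasiInterp_basis_eval N (p := 1) (by simp) x

lemma isLUB_lebesgueConst :
    IsLUB (Set.range (lebesgueFunction fun i => basis N i)) (lebesgueConst N) :=
  have : Nonempty I := ⟨node N 0⟩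
  isLUB_range_lebesgueFunction (node_injective N) (basis N)

lemma lebesgueFunction_basis_le (x : I) :
    lebesgueFunction (fun i => basis N i) x ≤ lebesgueConst N :=
  (isLUB_lebesgueConst N).1 (Set.mem_range_self x)

variable {N}

lemma one_lt_lebesgueConst (hN : 1 ≤ N) : 1 < lebesgueConst N := by
  let i₁ : Fin (N + 1) := ⟨1, by omega⟩
  let x₁ : I := ⟨1, by norm_num⟩
  have hneg : basis N i₁ x₁ < 0 := by
    have h := basis_mul_cos_sub_cos N i₁ (x := x₁) cos_zero.symm
    rw [mul_zero, cos_zero, show ((i₁ : Fin (N + 1)) : ℕ) = 1 from rfl] at h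
    refine neg_of_mul_neg_left (a := basis N i₁ x₁) (h.trans_lt ?_)
      (mul_nonneg (by positivity) (sub_nonneg.2 (cos_le_one _)))
    linarith [sin_angle_pos N i₁]
  calc 1 = ∑ i, basis N i x₁ := (sum_basis_eq_one N x₁).symm
    _ < ∑ i, |basis N i x₁| := Finset.sum_lt_sum (fun i _ => le_abs_self _)
        ⟨i₁, Finset.mem_univ _, hneg.trans_le (abs_nonneg _)⟩
    _ ≤ lebesgueConst N := lebesgueFunction_basis_le N x₁

end ChebyshevNodes

section CotangentSums

lemma sin_mul_sin_nat_mul_le {u v : ℝ} (hu : 0 ≤ u) (huv : u ≤ v) (n : ℕ)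
    (hv : n * v ≤ π / 2) : sin u * sin (n * v) ≤ sin v * sin (n * u) := by
  induction n with
  | zero => simp
  | succ n ih =>
    have hπ := pi_pos
    push_cast at hv ⊢
    rw [add_one_mul] at hv
    have hv0 : 0 ≤ v := hu.trans huv
    have hnv0 : 0 ≤ n * v := mul_nonneg n.cast_nonneg hv0
    have hnv : n * v ≤ π / 2 := by linarith
    have hv_le : v ≤ π / 2 := by linarith
    have hnuv : n * u ≤ n * v := by gcongr
    have hnu0 : 0 ≤ n * u := by positivity
    have hsu : 0 ≤ sin u := sin_nonneg_of_nonneg_of_le_pi hu (by linarith)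
    have hsuv : sin u ≤ sin v := sin_le_sin_of_le_of_le_pi_div_two (by linarith) hv_le huv
    have hsnu : 0 ≤ sin (n * u) := sin_nonneg_of_nonneg_of_le_pi hnu0 (by linarith)
    have hcv : 0 ≤ cos v := cos_nonneg_of_mem_Icc ⟨by linarith, hv_le⟩
    have hcuv : cos v ≤ cos u := cos_le_cos_of_nonneg_of_le_pi hu (by linarith) huv
    have hcnuv : cos (n * v) ≤ cos (n * u) :=
      cos_le_cos_of_nonneg_of_le_pi hnu0 (by linarith) hnuv
    calc sin u * sin ((n + 1) * v)
        = sin u * sin (n * v) * cos v + sin u * sin v * cos (n * v) := by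
          rw [add_mul, one_mul, sin_add]; ring
      _ ≤ sin v * sin (n * u) * cos u + sin u * sin v * cos (n * u) := by
          have hsv : 0 ≤ sin v := hsu.trans hsuv
          exact add_le_add (mul_le_mul (ih hnv) hcuv hcv (mul_nonneg hsv hsnu))
            (mul_le_mul_of_nonneg_left hcnuv (mul_nonneg hsu hsv))
      _ = sin v * sin ((n + 1) * u) := by
          rw [add_mul, one_mul, sin_add]; ring

lemma sin_add_mul_sin_sub (x u : ℝ) : sin (x + u) * sin (x - u) = sin x ^ 2 - sin u ^ 2 := by
  rw [sin_add, sin_sub]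
  linear_combination sin x ^ 2 * cos_sq' u - sin u ^ 2 * cos_sq' x

/-- The reason is `sin |u| / sin δ ≤ sin (n |u|) / sin (n δ)`, where `sin (n δ) = √2 / 2`. -/
lemma cos_two_nat_mul_mul_sin_sq_le {n : ℕ} {u x δ : ℝ} (hn : n * δ = π / 4) (hu : |u| ≤ δ)
    (hx : δ ≤ x) (hx' : x ≤ π / 2) :
    cos (2 * n * u) * sin x ^ 2 ≤ sin (x + u) * sin (x - u) := by
  wlog hu0 : 0 ≤ u generalizing u with H
  · simpa [← sub_eq_add_neg, mul_comm] using H (u := -u) (by rwa [abs_neg]) (by linarith)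
  rw [abs_of_nonneg hu0] at hu
  have hδ : sin u * (√2 / 2) ≤ sin δ * sin (n * u) := by
    have := sin_mul_sin_nat_mul_le hu0 hu n (by linarith [pi_pos])
    rwa [hn, sin_pi_div_four] at this
  have hnu : n * u ≤ π / 4 := hn ▸ mul_le_mul_of_nonneg_left hu n.cast_nonneg
  have hsnu : 0 ≤ sin (n * u) :=
    sin_nonneg_of_nonneg_of_le_pi (by positivity) (by linarith [pi_pos])
  have hsu : 0 ≤ sin u := sin_nonneg_of_nonneg_of_le_pi hu0 (by linarith [pi_pos])
  have hsin : sin u * (√2 / 2) ≤ sin x * sin (n * u) := hδ.trans <|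
    mul_le_mul_of_nonneg_right
      (sin_le_sin_of_le_of_le_pi_div_two (by linarith [pi_pos]) hx' hx) hsnu
  have hsq := pow_le_pow_left₀ (by positivity) hsin 2
  rw [mul_pow, mul_pow, div_pow, sq_sqrt zero_le_two] at hsq
  rw [sin_add_mul_sin_sub, mul_assoc, cos_two_mul, cos_sq']
  linarith

lemma abs_cot_neg (x : ℝ) : |cot (-x)| = |cot x| := by
  rw [cot_eq_cos_div_sin, cot_eq_cos_div_sin, cos_neg, sin_neg, div_neg, abs_neg]

lemma cot_nonneg_of_nonneg_of_le_pi_div_two {x : ℝ} (h0 : 0 ≤ x) (h : x ≤ π / 2) : 0 ≤ cot x := by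
  rw [cot_eq_cos_div_sin]
  exact div_nonneg (cos_nonneg_of_mem_Icc ⟨by linarith [pi_pos], h⟩)
    (sin_nonneg_of_nonneg_of_le_pi h0 (by linarith [pi_pos]))

lemma cot_add_add_cot_sub {x u : ℝ} (h₁ : sin (x + u) ≠ 0) (h₂ : sin (x - u) ≠ 0) :
    cot (x + u) + cot (x - u) = 2 * sin x * cos x / (sin (x + u) * sin (x - u)) := by
  have h := sin_add (x + u) (x - u)
  rw [show x + u + (x - u) = 2 * x by ring, sin_two_mul] at h
  rw [cot_eq_cos_div_sin, cot_eq_cos_div_sin, div_add_div _ _ h₁ h₂, h]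
  ring

lemma cos_mul_abs_cot_add_le {n : ℕ} {u x δ : ℝ} (hδ : 0 < δ) (hn : n * δ = π / 4)
    (hu : |u| ≤ δ) (hx : δ ≤ x) (hx' : x + δ ≤ π / 2) :
    cos (2 * n * u) * (|cot (u + x)| + |cot (u - x)|) ≤ 2 * cot x := by
  have hcx : 0 ≤ cot x := cot_nonneg_of_nonneg_of_le_pi_div_two (by linarith) (by linarith)
  rcases hu.eq_or_lt with hu | hu
  · have h0 : cos (2 * n * u) = 0 := by
      rw [← cos_abs, abs_mul, hu, abs_of_nonneg (by positivity), mul_assoc, hn,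
        show 2 * (π / 4) = π / 2 by ring, cos_pi_div_two]
    rw [h0, zero_mul]
    positivity
  obtain ⟨hu₁, hu₂⟩ := abs_lt.1 hu
  have hs₁ : 0 < sin (x + u) := sin_pos_of_pos_of_lt_pi (by linarith) (by linarith)
  have hs₂ : 0 < sin (x - u) := sin_pos_of_pos_of_lt_pi (by linarith) (by linarith)
  have hs : 0 < sin x := sin_pos_of_pos_of_lt_pi (by linarith) (by linarith)
  have hc : 0 ≤ cos x := cos_nonneg_of_mem_Icc ⟨by linarith, by linarith⟩
  have habs : |cot (u + x)| + |cot (u - x)| = cot (x + u) + cot (x - u) := by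
    rw [add_comm u, ← neg_sub x u, abs_cot_neg,
      abs_of_nonneg (cot_nonneg_of_nonneg_of_le_pi_div_two (by linarith) (by linarith)),
      abs_of_nonneg (cot_nonneg_of_nonneg_of_le_pi_div_two (by linarith) (by linarith))]
  rw [habs, cot_add_add_cot_sub hs₁.ne' hs₂.ne', cot_eq_cos_div_sin, mul_div_assoc',
    mul_div_assoc', div_le_div_iff₀ (mul_pos hs₁ hs₂) hs]
  calc cos (2 * n * u) * (2 * sin x * cos x) * sin x
      = 2 * cos x * (cos (2 * n * u) * sin x ^ 2) := by ring
    _ ≤ 2 * cos x * (sin (x + u) * sin (x - u)) := mul_le_mul_of_nonneg_left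
        (cos_two_nat_mul_mul_sin_sq_le hn hu.le hx (by linarith)) (by positivity)

lemma cot_periodic : Function.Periodic cot π := fun x => by
  rw [cot_eq_cos_div_sin, cot_eq_cos_div_sin, cos_add_pi, sin_add_pi, neg_div_neg_eq]

/-- The shifts by odd multiples of `δ` form a full period of a grid of step `2 * δ`. -/
lemma periodic_sum_add_odd_mul {f : ℝ → ℝ} {δ : ℝ} {n : ℕ}
    (hf : Function.Periodic f (4 * n * δ)) :
    Function.Periodic (fun v => ∑ i ∈ Finset.range n,
      (f (v + (2 * i + 1) * δ) + f (v - (2 * i + 1) * δ))) (2 * δ) := fun v => by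
  have telescope := Finset.sum_range_sub
    (fun i : ℕ => f (v + (2 * i + 1) * δ) - f (v - (2 * i - 1) * δ)) n
  have h_last : f (v + (2 * n + 1) * δ) = f (v - (2 * n - 1) * δ) := by
    rw [← hf (v - (2 * n - 1) * δ)]
    ring_nf
  have h_first : f (v + (2 * (0 : ℕ) + 1) * δ) = f (v - (2 * (0 : ℕ) - 1) * δ) := by
    push_cast
    ring_nf
  rw [h_last, h_first, sub_self, sub_self, sub_self] at telescope
  rw [← sub_eq_zero, ← telescope, ← Finset.sum_sub_distrib]
  refine Finset.sum_congr rfl fun i _ => ?_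
  push_cast
  ring_nf

lemma abs_cos_mul_sum_abs_cot_le {n : ℕ} (hn : 0 < n) (v : ℝ) :
    |cos (2 * n * v)| * ∑ i ∈ Finset.range n,
      (|cot (v + (2 * i + 1) * (π / (4 * n)))| + |cot (v - (2 * i + 1) * (π / (4 * n)))|) ≤
    2 * ∑ i ∈ Finset.range n, cot ((2 * i + 1) * (π / (4 * n))) := by
  have : (0 : ℝ) < n := by exact_mod_cast hn
  set δ := π / (4 * n) with hδ_def
  have hδ : 0 < δ := by positivity
  have hnδ : n * δ = π / 4 := by rw [hδ_def]; field_simp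
  have hper : Function.Periodic (fun x => |cot x|) (4 * n * δ) := by
    rw [mul_assoc, hnδ, mul_div_cancel₀ π four_ne_zero]
    exact fun x => congrArg abs (cot_periodic x)
  obtain ⟨u, p, hu, hvu⟩ : ∃ (u : ℝ) (p : ℤ), |u| ≤ δ ∧ u = v - p * (2 * δ) := by
    refine ⟨_, round (v / (2 * δ)), ?_, rfl⟩
    have h := abs_sub_round (v / (2 * δ))
    rw [div_sub' (by positivity), abs_div, abs_of_pos (show 0 < 2 * δ by positivity),
      div_le_iff₀ (by positivity), mul_comm (2 * δ)] at h
    linarith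
  have hcos : |cos (2 * n * v)| = cos (2 * n * u) := by
    have h2nu : 2 * n * u = 2 * n * v - p * π := by rw [hvu]; linear_combination (-4 * p) * hnδ
    have hle : |2 * n * u| ≤ π / 2 := by
      rw [abs_mul, abs_of_pos (by positivity)]
      calc 2 * n * |u| ≤ 2 * n * δ := by gcongr
        _ = π / 2 := by linear_combination 2 * hnδ
    rw [← abs_of_nonneg (cos_nonneg_of_mem_Icc (abs_le.1 hle) : 0 ≤ cos (2 * n * u)), h2nu,
      cos_sub_int_mul_pi, abs_mul, abs_zpow, abs_neg, abs_one, one_zpow, one_mul]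
  rw [hcos, ← (periodic_sum_add_odd_mul hper).sub_int_mul_eq (x := v) p, ← hvu, Finset.mul_sum,
    Finset.mul_sum]
  refine Finset.sum_le_sum fun i hi => ?_
  have hi : (i : ℝ) + 1 ≤ n := by exact_mod_cast Finset.mem_range.1 hi
  have hiδ : 0 ≤ i * δ := mul_nonneg i.cast_nonneg hδ.le
  exact cos_mul_abs_cot_add_le hδ hnδ hu (by linarith)
    (by linarith [mul_le_mul_of_nonneg_right hi hδ.le])

lemma mul_cos_le_sin {y : ℝ} (h0 : 0 ≤ y) (h : y ≤ π) : y * cos y ≤ sin y := by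
  have hsin : 0 ≤ sin y := sin_nonneg_of_nonneg_of_le_pi h0 h
  rcases lt_or_ge y (π / 2) with hy | hy
  · have hcos : 0 < cos y := cos_pos_of_mem_Ioo ⟨by linarith [pi_pos], hy⟩
    rw [← le_div_iff₀ hcos, ← tan_eq_sin_div_cos]
    exact le_tan h0 hy
  · have hcos : cos y ≤ 0 := cos_nonpos_of_pi_div_two_le_of_le hy (by linarith [pi_pos])
    exact (mul_nonpos_of_nonneg_of_nonpos h0 hcos).trans hsin

lemma cot_le_inv_sub {x : ℝ} (hx : 0 < x) (hx' : x < π) : cot x ≤ x⁻¹ - x / 3 := by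
  have hderiv (y : ℝ) : HasDerivAt (fun y : ℝ => (1 - y ^ 2 / 3) * sin y - y * cos y)
      (y / 3 * (sin y - y * cos y)) y := by
    refine ((((((hasDerivAt_id y).pow 2).div_const 3).const_sub 1).mul (hasDerivAt_sin y)).sub
      ((hasDerivAt_id y).mul (hasDerivAt_cos y))).congr_deriv ?_
    simp
    ring
  have hmono : MonotoneOn (fun y : ℝ => (1 - y ^ 2 / 3) * sin y - y * cos y) (Set.Icc 0 π) := by
    refine monotoneOn_of_hasDerivWithinAt_nonneg (convex_Icc 0 π)
      (fun y _ => (hderiv y).continuousAt.continuousWithinAt)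
      (fun y _ => (hderiv y).hasDerivWithinAt) fun y hy => ?_
    obtain ⟨hy0, hyπ⟩ := interior_subset hy
    exact mul_nonneg (by positivity) (sub_nonneg.2 (mul_cos_le_sin hy0 hyπ))
  have hsin : 0 < sin x := sin_pos_of_pos_of_lt_pi hx hx'
  have h : 0 ≤ (1 - x ^ 2 / 3) * sin x - x * cos x := by
    simpa using hmono ⟨le_rfl, pi_pos.le⟩ ⟨hx.le, hx'.le⟩ hx.le
  rw [cot_eq_cos_div_sin, div_le_iff₀ hsin]
  refine le_of_mul_le_mul_left ?_ hx
  calc x * cos x ≤ (1 - x ^ 2 / 3) * sin x := sub_nonneg.1 h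
    _ = x * ((x⁻¹ - x / 3) * sin x) := by field_simp

lemma inv_odd_le_log {n : ℕ} (hn : 0 < n) :
    (2 * (n : ℝ) + 1)⁻¹ ≤ (log (n + 1) - log n) / 2 := by
  have : (0 : ℝ) < n := by exact_mod_cast hn
  have h := Real.le_log_one_add_of_nonneg (x := (n : ℝ)⁻¹) (by positivity)
  rw [show 1 + (n : ℝ)⁻¹ = (n + 1) / n by field_simp, log_div (by positivity) (by positivity),
    show 2 * (n : ℝ)⁻¹ / ((n : ℝ)⁻¹ + 2) = 2 * (2 * (n : ℝ) + 1)⁻¹ by field_simp; ring] at h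
  linarith

/-- The constant makes this an equality for `n = 2`. -/
lemma sum_inv_odd_le {n : ℕ} (hn : 2 ≤ n) :
    ∑ i ∈ Finset.range n, (2 * (i : ℝ) + 1)⁻¹ ≤ log n / 2 + (4 / 3 - log 2 / 2) := by
  induction n, hn using Nat.le_induction with
  | base => norm_num [Finset.sum_range_succ]
  | succ n hn ih =>
    have := inv_odd_le_log (n := n) (by omega)
    rw [Finset.sum_range_succ]
    push_cast
    linarith

lemma sum_odd (n : ℕ) : ∑ i ∈ Finset.range n, (2 * (i : ℝ) + 1) = n ^ 2 := by
  induction n with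
  | zero => simp
  | succ n ih => rw [Finset.sum_range_succ, ih]; push_cast; ring

lemma four_div_pi_mul_sub_pi_div_twelve_le_one :
    4 / π * (4 / 3 - log 2 / 2) - π / 12 ≤ 1 := by
  rw [sub_le_iff_le_add, div_mul_eq_mul_div, div_le_iff₀ pi_pos]
  nlinarith [pi_gt_d4, log_two_gt_d9]

lemma sum_cot_le {n : ℕ} (hn : 0 < n) :
    ∑ i ∈ Finset.range n, cot ((2 * i + 1) * (π / (4 * n))) ≤ n * (2 / π * log n + 1) := by
  obtain rfl | hn2 : n = 1 ∨ 2 ≤ n := by omega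
  · simp [cot_eq_cos_div_sin]
  have hn' : (0 : ℝ) < n := by exact_mod_cast hn
  calc ∑ i ∈ Finset.range n, cot ((2 * i + 1) * (π / (4 * n)))
      ≤ ∑ i ∈ Finset.range n,
          (4 * n / π * (2 * (i : ℝ) + 1)⁻¹ - π / (12 * n) * (2 * i + 1)) := by
        refine Finset.sum_le_sum fun i hi => ?_
        have hi : (i : ℝ) + 1 ≤ n := by exact_mod_cast Finset.mem_range.1 hi
        refine (cot_le_inv_sub (by positivity) ?_).trans_eq ?_
        · rw [mul_div_assoc', div_lt_iff₀ (by positivity)]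
          nlinarith [pi_pos]
        · field_simp
          ring
    _ = 4 * n / π * ∑ i ∈ Finset.range n, (2 * (i : ℝ) + 1)⁻¹ - n * (π / 12) := by
        rw [Finset.sum_sub_distrib, ← Finset.mul_sum, ← Finset.mul_sum, sum_odd]
        field_simp
    _ ≤ 4 * n / π * (log n / 2 + (4 / 3 - log 2 / 2)) - n * (π / 12) := by
        gcongr
        exact sum_inv_odd_le hn2
    _ = n * (2 / π * log n + (4 / π * (4 / 3 - log 2 / 2) - π / 12)) := by ring
    _ ≤ n * (2 / π * log n + 1) := by
        gcongr
        exact four_div_pi_mul_sub_pi_div_twelve_le_one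

end CotangentSums

section LogarithmicBound

lemma two_mul_sin_div_cos_sub_cos {a θ : ℝ} (h : cos θ ≠ cos a) :
    2 * sin a / (cos θ - cos a) = cot (θ / 2 + a / 2) - cot (θ / 2 - a / 2) := by
  have hcos : cos θ - cos a = -2 * sin (θ / 2 + a / 2) * sin (θ / 2 - a / 2) := by
    rw [cos_sub_cos]
    ring_nf
  have hsin : sin a = sin (θ / 2 + a / 2) * cos (θ / 2 - a / 2) -
      cos (θ / 2 + a / 2) * sin (θ / 2 - a / 2) := by
    rw [← sin_sub]
    ring_nf
  have hne : sin (θ / 2 + a / 2) ≠ 0 ∧ sin (θ / 2 - a / 2) ≠ 0 := by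
    rw [← mul_ne_zero_iff, ← mul_ne_zero_iff_left (neg_ne_zero.2 (two_ne_zero (α := ℝ))),
      ← mul_assoc, ← hcos]
    exact sub_ne_zero.2 h
  rw [hcos, hsin, cot_eq_cos_div_sin, cot_eq_cos_div_sin]
  field [hne.1, hne.2]

variable (N : ℕ)

lemma lebesgueFunction_basis_node (j : Fin (N + 1)) :
    lebesgueFunction (fun i => basis N i) (node N j) = 1 := by
  simp [lebesgueFunction, basis_node, apply_ite abs]

variable {N}

lemma two_mul_succ_mul_abs_basis (i : Fin (N + 1)) {x : I} {θ : ℝ} (hθ : (x : ℝ) = cos θ)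
    (hx : x ≠ node N i) :
    2 * ((N : ℝ) + 1) * |basis N i x| = |cos (((N : ℝ) + 1) * θ)| *
      |cot (θ / 2 + angle N i / 2) - cot (θ / 2 - angle N i / 2)| := by
  have hne : cos θ ≠ cos (angle N i) := fun h => hx (Subtype.ext (hθ.trans h))
  have h := congrArg abs (basis_mul_cos_sub_cos N i hθ)
  simp only [abs_mul, abs_neg_one_pow, one_mul, abs_of_pos (Nat.cast_add_one_pos N : (0 : ℝ) < _)]
    at h
  rw [← two_mul_sin_div_cos_sub_cos hne, abs_div, abs_mul, abs_two]
  have : |cos θ - cos (angle N i)| ≠ 0 := abs_ne_zero.2 (sub_ne_zero.2 hne)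
  field_simp
  linarith

lemma succ_mul_lebesgueFunction_basis_le {x : I} (hx : ∀ i, x ≠ node N i) :
    (N + 1 : ℕ) * lebesgueFunction (fun i => basis N i) x ≤
      ∑ i ∈ Finset.range (N + 1), cot ((2 * i + 1) * (π / (4 * (N + 1 : ℕ)))) := by
  obtain ⟨θ, hθ⟩ := exists_eq_cos x
  let a (i : ℕ) : ℝ := (2 * i + 1) * (π / (4 * (N + 1 : ℕ)))
  have ha (i : Fin (N + 1)) : angle N i / 2 = a i := by
    simp only [angle, a]
    push_cast
    field_simp
    norm_num
  refine le_of_mul_le_mul_left ?_ two_pos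
  calc 2 * ((N + 1 : ℕ) * lebesgueFunction (fun i => basis N i) x)
      = ∑ i : Fin (N + 1), |cos (((N : ℝ) + 1) * θ)| * |cot (θ / 2 + a i) - cot (θ / 2 - a i)| := by
        simp only [lebesgueFunction, Finset.mul_sum, ← ha,
          ← two_mul_succ_mul_abs_basis _ hθ (hx _), Nat.cast_succ, mul_assoc]
    _ ≤ ∑ i : Fin (N + 1),
          |cos (((N : ℝ) + 1) * θ)| * (|cot (θ / 2 + a i)| + |cot (θ / 2 - a i)|) := by
        gcongr
        exact abs_sub _ _
    _ = |cos (2 * (N + 1 : ℕ) * (θ / 2))| * ∑ i ∈ Finset.range (N + 1),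
          (|cot (θ / 2 + a i)| + |cot (θ / 2 - a i)|) := by
        rw [← Finset.mul_sum,
          Fin.sum_univ_eq_sum_range fun i => |cot (θ / 2 + a i)| + |cot (θ / 2 - a i)|]
        push_cast
        ring_nf
    _ ≤ 2 * ∑ i ∈ Finset.range (N + 1), cot (a i) :=
        abs_cos_mul_sum_abs_cot_le N.succ_pos (θ / 2)

lemma lebesgueConst_le_log (N : ℕ) : lebesgueConst N ≤ 2 / π * log ((N : ℝ) + 1) + 1 := by
  refine (isLUB_lebesgueConst N).2 (Set.forall_mem_range.2 fun x => ?_)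
  by_cases hx : ∀ i, x ≠ node N i
  · have h := (succ_mul_lebesgueFunction_basis_le hx).trans (sum_cot_le N.succ_pos)
    exact_mod_cast le_of_mul_le_mul_left h (Nat.cast_pos.2 N.succ_pos)
  · push Not at hx
    obtain ⟨j, rfl⟩ := hx
    rw [lebesgueFunction_basis_node, le_add_iff_nonneg_left]
    have : 0 ≤ log ((N : ℝ) + 1) := log_nonneg (le_add_of_nonneg_left N.cast_nonneg)
    have := pi_pos
    positivity

end LogarithmicBound

section AnnulusEstimate

variable {E : Type*} [NormedAddCommGroup E] [NormedSpace ℂ E] {f : ℂ → E} {c : ℂ} {r R C : ℝ}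

lemma norm_circleIntegral_zpow_smul_le (hR : 0 < R) (hb : ∀ z, ‖z - c‖ = R → ‖f z‖ ≤ C) (n : ℤ) :
    ‖∮ z in C(c, R), (z - c)⁻¹ • (z - c) ^ (-n) • f z‖ ≤ 2 * π * (C / R ^ n) := by
  refine (circleIntegral.norm_integral_le_of_norm_le_const (C := R⁻¹ * (C / R ^ n)) hR.le
    fun z hz => ?_).trans_eq (by field_simp)
  have hz : ‖z - c‖ = R := by simpa using hz
  rw [norm_smul, norm_smul, norm_inv, norm_zpow, hz, zpow_neg, div_eq_inv_mul C]
  gcongr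
  exact hb z hz

lemma circleIntegral_zpow_smul_eq_of_differentiableAt_annulus (hr : 0 < r) (hrR : r ≤ R)
    (hd : ∀ z, r ≤ ‖z - c‖ → ‖z - c‖ ≤ R → DifferentiableAt ℂ f z) (n : ℤ) :
    ∮ z in C(c, R), (z - c)⁻¹ • (z - c) ^ n • f z =
      ∮ z in C(c, r), (z - c)⁻¹ • (z - c) ^ n • f z := by
  have hd' (z : ℂ) (hz : z ∈ Metric.closedBall c R \ Metric.ball c r) :
      DifferentiableAt ℂ (fun z => (z - c) ^ n • f z) z := by
    simp only [Set.mem_sdiff, mem_closedBall_iff_norm, mem_ball_iff_norm, not_lt] at hz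
    have hne : z - c ≠ 0 := norm_pos_iff.1 (hr.trans_le hz.2)
    exact ((differentiableAt_id.sub_const c).zpow (Or.inl hne)).smul (hd z hz.2 hz.1)
  refine Complex.circleIntegral_sub_center_inv_smul_eq_of_differentiable_on_annulus_off_countable
    hr hrR Set.countable_empty (fun z hz => (hd' z hz).continuousAt.continuousWithinAt)
    fun z hz => hd' z ?_
  exact Set.sdiff_subset_sdiff Metric.ball_subset_closedBall Metric.ball_subset_closedBall hz.1

lemma norm_circleIntegral_zpow_smul_le_of_differentiableAt_annulus (hr : 0 < r) (hrR : r < R)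
    (hd : ∀ z, r ≤ ‖z - c‖ → ‖z - c‖ < R → DifferentiableAt ℂ f z)
    (hb : ∀ z, r ≤ ‖z - c‖ → ‖z - c‖ < R → ‖f z‖ ≤ C) (n : ℤ) :
    ‖∮ z in C(c, r), (z - c)⁻¹ • (z - c) ^ (-n) • f z‖ ≤ 2 * π * (C / R ^ n) := by
  have hs {s : ℝ} (hrs : r < s) (hsR : s < R) :
      ‖∮ z in C(c, r), (z - c)⁻¹ • (z - c) ^ (-n) • f z‖ ≤ 2 * π * (C / s ^ n) := by
    rw [← circleIntegral_zpow_smul_eq_of_differentiableAt_annulus hr hrs.le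
      fun z hz hz' => hd z hz (hz'.trans_lt hsR)]
    exact norm_circleIntegral_zpow_smul_le (hr.trans hrs)
      (fun z hz => hb z (hz ▸ hrs.le) (hz ▸ hsR)) n
  have hR : R ≠ 0 := (hr.trans hrR).ne'
  have hcont : ContinuousAt (fun s : ℝ => 2 * π * (C / s ^ n)) R :=
    continuousAt_const.mul (continuousAt_const.div (continuousAt_zpow₀ R n (Or.inl hR))
      (zpow_ne_zero n hR))
  refine ge_of_tendsto (hcont.tendsto.mono_left (nhdsWithin_le_nhds (s := Set.Iio R))) ?_
  filter_upwards [Ioo_mem_nhdsLT hrR] with s h using hs h.1 h.2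

end AnnulusEstimate

section ChebyshevExpansion

lemma fourierCoeff_neg_of_even {T : ℝ} [Fact (0 < T)] {E : Type*} [NormedAddCommGroup E]
    [NormedSpace ℂ E] {f : AddCircle T → E} (hf : f.Even) (n : ℤ) :
    fourierCoeff f (-n) = fourierCoeff f n := by
  unfold fourierCoeff
  rw [← integral_neg_eq_self]
  refine integral_congr_ae (Filter.Eventually.of_forall fun t => ?_)
  simp only [hf t, fourier_apply, smul_neg, neg_smul, neg_neg]

lemma hasSum_fourierCoeff_mul_re_of_even {T : ℝ} [Fact (0 < T)] {f : C(AddCircle T, ℂ)}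
    (hf : Function.Even f) (hsum : Summable (fourierCoeff f)) (t : AddCircle T) :
    HasSum (fun n => fourierCoeff f n * ((fourier n t).re : ℂ)) (f t) := by
  have h := ((has_pointwise_sum_fourier_series_of_summable hsum t).add
    (has_pointwise_sum_fourier_series_of_summable hsum (-t))).mul_left (1 / 2)
  rw [hf t, ← two_mul, ← mul_assoc, one_div, inv_mul_cancel₀ two_ne_zero, one_mul] at h
  refine h.congr_fun fun n => ?_
  have hconj : fourier n (-t) = (starRingEnd ℂ) (fourier n t) := by
    rw [← fourier_neg, fourier_apply, fourier_apply, smul_neg, neg_smul]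
  rw [smul_eq_mul, smul_eq_mul, ← mul_add, hconj, Complex.add_conj]
  push_cast
  ring

local instance : Fact (0 < 2 * π) := ⟨two_pi_pos⟩

lemma toCircle_coe_two_pi (θ : ℝ) :
    (AddCircle.toCircle (θ : AddCircle (2 * π)) : ℂ) = Complex.exp (θ * Complex.I) := by
  rw [AddCircle.toCircle_apply_mk, div_self two_pi_pos.ne', one_mul, Circle.coe_exp]

lemma circleIntegral_zpow_smul_eq_fourierCoeff {E : Type*} [NormedAddCommGroup E] [NormedSpace ℂ E]
    (f : ℂ → E) (n : ℤ) :
    ∮ z in C(0, 1), (z - 0)⁻¹ • (z - 0) ^ (-n) • f z =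
      (2 * π * Complex.I) • fourierCoeff (fun t : AddCircle (2 * π) => f t.toCircle) n := by
  rw [fourierCoeff_eq_intervalIntegral _ _ 0, zero_add, circleIntegral, ← Complex.coe_smul,
    smul_smul, show 2 * (π : ℂ) * Complex.I * ((1 / (2 * π) : ℝ) : ℂ) = Complex.I by
      push_cast; field_simp, ← intervalIntegral.integral_smul]
  refine intervalIntegral.integral_congr fun θ _ => ?_
  have hz : circleMap 0 1 θ = AddCircle.toCircle (θ : AddCircle (2 * π)) := by
    rw [toCircle_coe_two_pi, circleMap_zero, Complex.ofReal_one, one_mul]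
  simp only [deriv_circleMap, hz, sub_zero, smul_smul, fourier_apply, AddCircle.toCircle_zsmul,
    Circle.coe_zpow]
  field_simp

lemma norm_fourierCoeff_toCircle_le {E : Type*} [NormedAddCommGroup E] [NormedSpace ℂ E]
    {f : ℂ → E} {R C : ℝ} (hR : 1 < R)
    (hd : ∀ z, 1 ≤ ‖z‖ → ‖z‖ < R → DifferentiableAt ℂ f z)
    (hb : ∀ z, 1 ≤ ‖z‖ → ‖z‖ < R → ‖f z‖ ≤ C) (n : ℤ) :
    ‖fourierCoeff (fun t : AddCircle (2 * π) => f t.toCircle) n‖ ≤ C / R ^ n := by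
  have h := norm_circleIntegral_zpow_smul_le_of_differentiableAt_annulus (c := 0) one_pos hR
    (by simpa only [sub_zero] using hd) (by simpa only [sub_zero] using hb) n
  rw [circleIntegral_zpow_smul_eq_fourierCoeff, norm_smul, norm_mul, norm_mul, Complex.norm_I,
    Complex.norm_ofNat, Complex.norm_of_nonneg pi_pos.le, mul_one] at h
  exact le_of_mul_le_mul_left h two_pi_pos

lemma even_comp_toCircle {T : ℝ} {E : Type*} {f : ℂ → E} (hf : ∀ z, f z⁻¹ = f z) :
    Function.Even fun t : AddCircle T => f t.toCircle := fun t => by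
  simp only [AddCircle.toCircle_neg, Circle.coe_inv, hf]

lemma norm_fourierCoeff_toCircle_le_of_inv {E : Type*} [NormedAddCommGroup E] [NormedSpace ℂ E]
    {f : ℂ → E} {R C : ℝ} (hR : 1 < R)
    (hd : ∀ z, 1 ≤ ‖z‖ → ‖z‖ < R → DifferentiableAt ℂ f z)
    (hb : ∀ z, 1 ≤ ‖z‖ → ‖z‖ < R → ‖f z‖ ≤ C) (hf : ∀ z, f z⁻¹ = f z) (n : ℤ) :
    ‖fourierCoeff (fun t : AddCircle (2 * π) => f t.toCircle) n‖ ≤ C * R⁻¹ ^ n.natAbs := by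
  have heven := even_comp_toCircle (T := 2 * π) hf
  have hnat : fourierCoeff (fun t : AddCircle (2 * π) => f t.toCircle) n =
      fourierCoeff (fun t : AddCircle (2 * π) => f t.toCircle) (n.natAbs : ℤ) := by
    rcases Int.natAbs_eq n with h | h
    · rw [← h]
    · conv_lhs => rw [h, fourierCoeff_neg_of_even heven]
  rw [hnat, inv_pow, ← div_eq_mul_inv, ← zpow_natCast]
  exact norm_fourierCoeff_toCircle_le hR hd hb _

lemma summable_pow_natAbs {r : ℝ} (h0 : 0 ≤ r) (h1 : r < 1) :
    Summable fun n : ℤ => r ^ n.natAbs :=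
  Summable.of_nat_of_neg (by simpa using summable_geometric_of_lt_one h0 h1)
    (by simpa using summable_geometric_of_lt_one h0 h1)

/-- The Joukowski map. It takes the annulus `1 ≤ ‖w‖ < ρ` to the region inside the Bernstein
ellipse, and `exp (θ i)` to `cos θ`. -/
def joukowski (w : ℂ) : ℂ := (w + w⁻¹) / 2

lemma joukowski_mem_bernsteinEllipse {ρ : ℝ} {w : ℂ} (h1 : 1 ≤ ‖w‖) (h2 : ‖w‖ < ρ) :
    joukowski w ∈ bernsteinEllipse ρ := ⟨w, ⟨h1, h2⟩, rfl⟩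

lemma joukowski_inv (w : ℂ) : joukowski w⁻¹ = joukowski w := by
  rw [joukowski, joukowski, inv_inv, add_comm]

lemma differentiableAt_joukowski {w : ℂ} (hw : w ≠ 0) : DifferentiableAt ℂ joukowski w :=
  (differentiableAt_id.add (differentiableAt_inv hw)).div_const 2

lemma joukowski_coe_circle (z : Circle) : joukowski z = ((z : ℂ).re : ℂ) := by
  rw [joukowski, ← Circle.coe_inv, Circle.coe_inv_eq_conj, Complex.add_conj]
  push_cast
  ring

lemma re_toCircle_coe_two_pi (θ : ℝ) :
    (AddCircle.toCircle (θ : AddCircle (2 * π)) : ℂ).re = cos θ := by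
  rw [toCircle_coe_two_pi, Complex.exp_ofReal_mul_I_re]

lemma re_fourier_two_pi (n : ℤ) (θ : ℝ) :
    (fourier n (θ : AddCircle (2 * π))).re = (Chebyshev.T ℝ n).eval (cos θ) := by
  rw [fourier_apply, ← AddCircle.coe_zsmul, re_toCircle_coe_two_pi, Chebyshev.T_real_cos,
    zsmul_eq_mul]

variable {f : I → ℝ} {G : ℂ → ℂ} {ρ C : ℝ}

lemma exists_hasSum_mul_eval_T (hρ : 1 < ρ) (hG : AnalyticOnNhd ℂ G (bernsteinEllipse ρ))
    (hb : ∀ z ∈ bernsteinEllipse ρ, ‖G z‖ ≤ C) (hf : ∀ t : I, G ((t : ℝ) : ℂ) = (f t : ℂ)) :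
    ∃ a : ℤ → ℝ, (∀ n, |a n| ≤ C * ρ⁻¹ ^ n.natAbs) ∧
      ∀ t : I, HasSum (fun n => a n * (Chebyshev.T ℝ n).eval (t : ℝ)) (f t) := by
  let H (w : ℂ) : ℂ := G (joukowski w)
  have hH (w : ℂ) (h1 : 1 ≤ ‖w‖) (h2 : ‖w‖ < ρ) : DifferentiableAt ℂ H w :=
    (hG _ (joukowski_mem_bernsteinEllipse h1 h2)).differentiableAt.comp w
      (differentiableAt_joukowski (norm_pos_iff.1 (one_pos.trans_le h1)))
  have hHinv (w : ℂ) : H w⁻¹ = H w := congrArg G (joukowski_inv w)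
  let F : C(AddCircle (2 * π), ℂ) := ⟨fun t => H t.toCircle, continuous_iff_continuousAt.2 fun t =>
    (hH _ (Circle.norm_coe _).ge ((Circle.norm_coe _).trans_lt hρ)).continuousAt.comp
      (f := fun t : AddCircle (2 * π) => (t.toCircle : ℂ))
      (continuous_subtype_val.comp AddCircle.continuous_toCircle).continuousAt⟩
  have hcoeff (n : ℤ) : ‖fourierCoeff F n‖ ≤ C * ρ⁻¹ ^ n.natAbs :=
    norm_fourierCoeff_toCircle_le_of_inv hρ hH
      (fun w h1 h2 => hb _ (joukowski_mem_bernsteinEllipse h1 h2)) hHinv n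
  have hsum : Summable (fourierCoeff F) := .of_norm_bounded ((summable_pow_natAbs
    (inv_nonneg.2 (one_pos.trans hρ).le) (inv_lt_one_of_one_lt₀ hρ)).mul_left C) hcoeff
  refine ⟨fun n => (fourierCoeff F n).re, fun n => (Complex.abs_re_le_norm _).trans (hcoeff n),
    fun t => ?_⟩
  obtain ⟨θ, hθ⟩ := exists_eq_cos t
  have hFθ : F (θ : AddCircle (2 * π)) = f t := by
    change G (joukowski _) = _
    rw [joukowski_coe_circle, re_toCircle_coe_two_pi, ← hθ, hf]
  have h := Complex.hasSum_re (hasSum_fourierCoeff_mul_re_of_even (even_comp_toCircle hHinv) hsum θ)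
  simpa only [Complex.re_mul_ofReal, re_fourier_two_pi, ← hθ, hFθ, Complex.ofReal_re] using h

end ChebyshevExpansion

section InterpolationError

lemma hasSum_geometric_tail {r : ℝ} (h0 : 0 ≤ r) (h1 : r < 1) (N : ℕ) :
    HasSum (fun n : ℕ => if n ≤ N then 0 else r ^ n) (r ^ (N + 1) / (1 - r)) := by
  have hz : ∑ i ∈ Finset.range (N + 1), (if i ≤ N then 0 else r ^ i) = 0 :=
    Finset.sum_eq_zero fun i hi => if_pos (Nat.lt_succ_iff.1 (Finset.mem_range.1 hi))
  rw [← hasSum_nat_add_iff' (N + 1), hz, sub_zero, div_eq_mul_inv]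
  refine ((hasSum_geometric_of_lt_one h0 h1).mul_left (r ^ (N + 1))).congr_fun fun n => ?_
  rw [if_neg (by omega), pow_add, mul_comm]

lemma hasSum_int_geometric_tail {r : ℝ} (h0 : 0 ≤ r) (h1 : r < 1) (N : ℕ) :
    HasSum (fun n : ℤ => if n.natAbs ≤ N then 0 else r ^ n.natAbs)
      (2 * (r ^ (N + 1) / (1 - r))) := by
  have h := hasSum_geometric_tail h0 h1 N
  have h' := (hasSum_nat_add_iff' 1).2 h
  simp only [Finset.range_one, Finset.sum_singleton, zero_le, if_true, sub_zero] at h'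
  rw [two_mul]
  refine HasSum.of_nat_of_neg_add_one (f := fun n : ℤ => if n.natAbs ≤ N then 0 else r ^ n.natAbs)
    (by simpa using h) (h'.congr_fun fun n => ?_)
  rw [show (-((n : ℤ) + 1)).natAbs = n + 1 by omega]

lemma eval_T_two_mul_succ_mul_add (N : ℕ) (i : Fin (N + 1)) (q r : ℤ) :
    (Chebyshev.T ℝ (2 * (N + 1) * q + r)).eval (node N i : ℝ) =
      (-1) ^ q * (Chebyshev.T ℝ r).eval (node N i : ℝ) := by
  have hangle : ((2 * (N + 1) * q + r : ℤ) : ℝ) * angle N i =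
      r * angle N i + ((q * (2 * (i : ℕ) + 1) : ℤ) : ℝ) * π := by
    push_cast
    linear_combination 2 * (q : ℝ) * succ_mul_angle N i
  have hsign : (-1 : ℝ) ^ (2 * (i : ℕ) + 1 : ℤ) = -1 := (odd_two_mul_add_one _).neg_one_zpow
  rw [coe_node, Chebyshev.T_real_cos, Chebyshev.T_real_cos, hangle, cos_add_int_mul_pi,
    zpow_mul', hsign]

/-- At the nodes every `T_k` agrees up to sign with some `T_r`, `|r| ≤ N + 1`, and `T_{N + 1}`
vanishes there. -/
lemma abs_quasiInterp_T_le_one (N : ℕ) (k : ℤ) (x : I) :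
    |quasiInterp (node N) (fun i => basis N i) (fun t => (Chebyshev.T ℝ k).eval (t : ℝ)) x| ≤
      1 := by
  obtain ⟨q, r, rfl, hr⟩ : ∃ q r : ℤ, k = 2 * (N + 1) * q + r ∧ r.natAbs ≤ N + 1 := by
    refine ⟨Int.bdiv k (2 * (N + 1)), Int.bmod k (2 * (N + 1)), ?_, ?_⟩
    · have := Int.bdiv_add_bmod k (2 * (N + 1))
      push_cast at this
      exact this.symm
    · have := Int.le_bmod (x := k) (m := 2 * (N + 1)) (by omega)
      have := Int.bmod_lt (x := k) (m := 2 * (N + 1)) (by omega)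
      omega
  have halias : quasiInterp (node N) (fun i => basis N i)
      (fun t => (Chebyshev.T ℝ (2 * (N + 1) * q + r)).eval (t : ℝ)) x = (-1) ^ q *
      quasiInterp (node N) (fun i => basis N i) (fun t => (Chebyshev.T ℝ r).eval (t : ℝ)) x := by
    simp only [quasiInterp, eval_T_two_mul_succ_mul_add, Finset.mul_sum]
    exact Finset.sum_congr rfl fun i _ => mul_assoc _ _ _
  rw [halias, abs_mul, abs_neg_one_zpow, one_mul]
  rcases hr.lt_or_eq with hlt | heq
  · rw [quasiInterp_basis_eval N (by rw [Chebyshev.natDegree_T]; omega)]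
    exact Chebyshev.abs_eval_T_real_le_one r (abs_le.2 x.2)
  · have hT : Chebyshev.T ℝ r = Chebyshev.T ℝ (N + 1) := by
      rcases Int.natAbs_eq r with h | h <;> rw [h, heq] <;> push_cast
      · rfl
      · exact Chebyshev.T_neg ℝ _
    simp [quasiInterp, hT, eval_T_node]

lemma abs_sub_quasiInterp_basis_le_of_hasSum_T {f : I → ℝ} {a : ℤ → ℝ} {r C : ℝ} (hr0 : 0 ≤ r)
    (hr1 : r < 1) (ha : ∀ n, |a n| ≤ C * r ^ n.natAbs)
    (hf : ∀ t : I, HasSum (fun n => a n * (Chebyshev.T ℝ n).eval (t : ℝ)) (f t)) (N : ℕ) (x : I) :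
    |f x - quasiInterp (node N) (fun i => basis N i) f x| ≤ 4 * C * r ^ (N + 1) / (1 - r) := by
  let P (n : ℤ) : ℝ :=
    quasiInterp (node N) (fun i => basis N i) (fun t => (Chebyshev.T ℝ n).eval (t : ℝ)) x
  have hC : 0 ≤ C := by simpa using (abs_nonneg _).trans (ha 0)
  have herror : HasSum (fun n => a n * ((Chebyshev.T ℝ n).eval (x : ℝ) - P n))
      (f x - quasiInterp (node N) (fun i => basis N i) f x) := by
    refine ((hf x).sub (hasSum_sum fun i _ => (hf (node N i)).mul_right (basis N i x))).congr_fun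
      fun n => ?_
    simp only [P, quasiInterp, mul_sub, Finset.mul_sum, mul_assoc]
  have hterm (n : ℤ) : |a n * ((Chebyshev.T ℝ n).eval (x : ℝ) - P n)| ≤
      2 * C * if n.natAbs ≤ N then 0 else r ^ n.natAbs := by
    split_ifs with hn
    · have hP : P n = (Chebyshev.T ℝ n).eval (x : ℝ) :=
        quasiInterp_basis_eval N (by rwa [Chebyshev.natDegree_T]) x
      rw [hP, sub_self, mul_zero, mul_zero, abs_zero]
    · have htwo : |(Chebyshev.T ℝ n).eval (x : ℝ) - P n| ≤ 2 := (abs_sub _ _).trans <|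
        (add_le_add (Chebyshev.abs_eval_T_real_le_one n (abs_le.2 x.2))
          (abs_quasiInterp_T_le_one N n x)).trans_eq one_add_one_eq_two
      calc |a n * ((Chebyshev.T ℝ n).eval (x : ℝ) - P n)|
          ≤ C * r ^ n.natAbs * 2 := by
            rw [abs_mul]
            exact mul_le_mul (ha n) htwo (abs_nonneg _) (by positivity)
        _ = 2 * C * r ^ n.natAbs := by ring
  exact (herror.norm_le_of_bounded ((hasSum_int_geometric_tail hr0 hr1 N).mul_left (2 * C))
    hterm).trans_eq (by ring)

lemma abs_sub_quasiInterp_basis_le {f : I → ℝ} {G : ℂ → ℂ} {ρ C : ℝ} (hρ : 1 < ρ)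
    (hG : AnalyticOnNhd ℂ G (bernsteinEllipse ρ)) (hb : ∀ z ∈ bernsteinEllipse ρ, ‖G z‖ ≤ C)
    (hf : ∀ t : I, G ((t : ℝ) : ℂ) = (f t : ℂ)) (N : ℕ) (x : I) :
    |f x - quasiInterp (node N) (fun i => basis N i) f x| ≤ 4 * C / ((ρ - 1) * ρ ^ N) := by
  obtain ⟨a, ha, hsum⟩ := exists_hasSum_mul_eval_T hρ hG hb hf
  have hρ0 : 0 < ρ := one_pos.trans hρ
  refine (abs_sub_quasiInterp_basis_le_of_hasSum_T (inv_nonneg.2 hρ0.le)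
    (inv_lt_one_of_one_lt₀ hρ) ha hsum N x).trans_eq ?_
  have : ρ - 1 ≠ 0 := (sub_pos.2 hρ).ne'
  rw [show 1 - ρ⁻¹ = (ρ - 1) / ρ by field_simp, inv_pow, pow_succ]
  field_simp

end InterpolationError

section TensorizedInterpolation

variable {m : ℕ} (N : Fin m → ℕ)

lemma tensorInterp_eq_quasiInterp : tensorInterp N =
    quasiInterp (Pi.map fun k => node (N k)) (tensorBasis fun k i => basis (N k) i) := rfl

lemma tensorInterp_add (f g : (Fin m → I) → ℝ) (x : Fin m → I) :
    tensorInterp N (f + g) x = tensorInterp N f x + tensorInterp N g x := by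
  rw [tensorInterp_eq_quasiInterp, quasiInterp_add]

lemma HasBoundedContinuation.abs_sub_quasiInterp_update_le {g : (Fin m → I) → ℝ} {k : Fin m}
    {ρ C : ℝ} (hg : HasBoundedContinuation g k ρ C) (hρ : 1 < ρ) (n : ℕ) (x : Fin m → I) :
    |g x - quasiInterp (node n) (fun i => basis n i) (fun t => g (Function.update x k t)) (x k)| ≤
      4 * C / ((ρ - 1) * ρ ^ n) := by
  obtain ⟨G, hG, hb, hf⟩ := hg x
  simpa only [Function.update_eq_self] using
    abs_sub_quasiInterp_basis_le (f := fun t => g (Function.update x k t)) hρ hG hb hf n (x k)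

lemma HasBoundedContinuation.nonneg {g : (Fin m → I) → ℝ} {k : Fin m} {ρ C : ℝ}
    (hg : HasBoundedContinuation g k ρ C) (hρ : 1 < ρ) : 0 ≤ C := by
  obtain ⟨G, -, hb, -⟩ := hg fun _ => node 0 0
  exact (norm_nonneg _).trans
    (hb _ (joukowski_mem_bernsteinEllipse (w := 1) (by simp) (by simpa using hρ)))

lemma prod_lebesgueFunction_basis_le (s : Finset (Fin m)) (x : Fin m → I) :
    ∏ k ∈ s, lebesgueFunction (fun i => basis (N k) i) (x k) ≤ ∏ k ∈ s, lebesgueConst (N k) :=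
  Finset.prod_le_prod (fun _ _ => lebesgueFunction_nonneg _ _)
    fun k _ => lebesgueFunction_basis_le (N k) (x k)

lemma abs_tensorInterp_le (e : (Fin m → I) → ℝ) (x : Fin m → I) :
    |tensorInterp N e x| ≤ (∏ k, lebesgueConst (N k)) * ‖fun i => e (grid N i)‖ := by
  refine (abs_sum_mul_le_lebesgueFunction_mul (norm_le_pi_norm fun i => e (grid N i))
    (tensorBasis fun k i => basis (N k) i) x).trans ?_
  rw [lebesgueFunction_tensorBasis]
  exact mul_le_mul_of_nonneg_right (prod_lebesgueFunction_basis_le N _ x) (norm_nonneg _)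

lemma abs_sub_tensorInterp_le {g : (Fin m → I) → ℝ} {ρ C : Fin m → ℝ} (hρ : ∀ k, 1 < ρ k)
    (hg : ∀ k, HasBoundedContinuation g k (ρ k) (C k)) (x : Fin m → I) :
    |g x - tensorInterp N g x| ≤
      ∑ k, 4 * (∏ j with j < k, lebesgueConst (N j)) * C k / ((ρ k - 1) * ρ k ^ N k) := by
  rw [tensorInterp_eq_quasiInterp]
  refine (abs_sub_quasiInterp_tensorBasis_le
    (fun k => (hg k).abs_sub_quasiInterp_update_le (hρ k) (N k)) x).trans
    (Finset.sum_le_sum fun k _ => ?_)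
  have hC : 0 ≤ 4 * C k / ((ρ k - 1) * ρ k ^ N k) := by
    have := (hg k).nonneg (hρ k)
    have := sub_pos.2 (hρ k)
    have := one_pos.trans (hρ k)
    positivity
  exact (mul_le_mul_of_nonneg_right (prod_lebesgueFunction_basis_le N _ x) hC).trans_eq (by ring)

lemma abs_sub_tensorInterp_add_le {g : (Fin m → I) → ℝ} {ρ C : Fin m → ℝ} (hρ : ∀ k, 1 < ρ k)
    (hg : ∀ k, HasBoundedContinuation g k (ρ k) (C k)) (e : (Fin m → I) → ℝ) (x : Fin m → I) :
    |g x - tensorInterp N (g + e) x| ≤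
      (∑ k, 4 * (∏ j with j < k, lebesgueConst (N j)) * C k / ((ρ k - 1) * ρ k ^ N k)) +
        (∏ k, lebesgueConst (N k)) * ‖fun i => e (grid N i)‖ := by
  rw [tensorInterp_add, ← sub_sub]
  exact (abs_sub _ _).trans (add_le_add (abs_sub_tensorInterp_le N hρ hg x)
    (abs_tensorInterp_le N e x))

lemma sum_pow_card_filter_lt {K : Type*} [Field K] {a : K} (ha : a ≠ 1) (m : ℕ) :
    ∑ k : Fin m, a ^ (Finset.univ.filter (· < k)).card = (a ^ m - 1) / (a - 1) := by
  simp only [Finset.filter_gt_eq_Iio, Fin.card_Iio]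
  rw [Fin.sum_univ_eq_sum_range (fun k => a ^ k) m, geom_sum_eq ha]

end TensorizedInterpolation

end ChebInterp

end

theorem mainTheorem5 (m : ℕ) (g e : (Fin m → ChebInterp.I) → ℝ)
    (N : Fin m → ℕ) (ρ C : Fin m → ℝ) (hρ : ∀ k, 1 < ρ k)
    (hg : ∀ k, ChebInterp.HasBoundedContinuation g k (ρ k) (C k)) :
    (∀ n : ℕ, ChebInterp.lebesgueConst n ≤ 2 / Real.pi * Real.log ((n : ℝ) + 1) + 1) ∧
    (∀ x : Fin m → ChebInterp.I,
      |g x - ChebInterp.tensorInterp N (g + e) x| ≤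
        (∑ k, 4 * (∏ j ∈ Finset.univ.filter (fun j => j < k), ChebInterp.lebesgueConst (N j)) * C k
            / ((ρ k - 1) * ρ k ^ N k))
          + (∏ k, ChebInterp.lebesgueConst (N k)) * ‖fun i => e (ChebInterp.grid N i)‖) ∧
    (∀ (N₀ : ℕ) (ρ₀ C₀ : ℝ), 1 ≤ N₀ → (∀ k, N k = N₀) → (∀ k, ρ k = ρ₀) → (∀ k, C k = C₀) →
      1 < ChebInterp.lebesgueConst N₀ ∧
      ∀ x : Fin m → ChebInterp.I,
        |g x - ChebInterp.tensorInterp N (g + e) x| ≤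
          4 * (ChebInterp.lebesgueConst N₀ ^ m - 1) * C₀
              / ((ρ₀ - 1) * ρ₀ ^ N₀ * (ChebInterp.lebesgueConst N₀ - 1))
            + ChebInterp.lebesgueConst N₀ ^ m * ‖fun i => e (ChebInterp.grid N i)‖) := by
  have error_bound := ChebInterp.abs_sub_tensorInterp_add_le N hρ hg e
  refine ⟨ChebInterp.lebesgueConst_le_log, error_bound, fun N₀ ρ₀ C₀ hN₀ hN hρ₀ hC => ?_⟩
  have hΛ := ChebInterp.one_lt_lebesgueConst hN₀
  refine ⟨hΛ, fun x => (error_bound x).trans_eq ?_⟩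
  simp only [hN, hρ₀, hC, ← Finset.sum_div, ← Finset.sum_mul, ← Finset.mul_sum,
    Finset.prod_const, Finset.card_univ, Fintype.card_fin,
    ChebInterp.sum_pow_card_filter_lt hΛ.ne']
  rw [mul_div_assoc', div_mul_eq_mul_div, div_div, mul_comm (ChebInterp.lebesgueConst N₀ - 1)]
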